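/- Let $\Gamma$ be a finite tree with vertex set $\mathcal V$, each vertex $v$ decorated by an integer $e_v$ (a plumbing graph with all genera zero), such that the intersection form $(E_v,E_v)=e_v$, $(E_v,E_w)=1$ if $v\neq w$ are adjacent and $0$ otherwise, is negative definite on $L=\mathbb Z\langle E_v\rangle_{v\in\mathcal V}$. Let $L'=\{l'\in L\otimes\mathbb Q:(l',E_v)\in\mathbb Z\ \forall v\}$, $H=L'/L$, and let $E_v^*\in L'$ be given by $(E_v^*,E_w)=-\delta_{vw}$. Let $\delta_v$ be the valency of $v$, and assume that the set of nodes $\mathcal N=\{n\in\mathcal V:\delta_n\ge 3\}$ is non-empty. Write $\mathbf t^{l}=\prod_v t_v^{l_v}$ for $l=\sum_v l_vE_v$, and let $\pi_{\mathcal N}:L\otimes\mathbb Q\to\mathbb Q^{\mathcal N}$ be the projection to the node coordinates. For $a,b\in\mathbb Q^{\mathcal N}$ write $a<b$ if $a_n<b_n$ for all $n\in\mathcal N$. Let $f(\mathbf t)=\prod_{v}(1-\mathbf t^{E_v^*})^{\delta_v-2}$, with Taylor expansion $Z(\mathbf t)=\sum_{l'}p_{l'}\mathbf t^{l'}$ at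 the origin. For $h\in H$ let $f_h(\mathbf t)$ be the rational function with Taylor expansion $Z_h(\mathbf t)=\sum_{[l']=h}p_{l'}\mathbf t^{l'}$, and let $f_h(\mathbf t_{\mathcal N})=f_h(\mathbf t)|_{t_v=1,\,v\notin\mathcal N}$ be the reduced zeta-function. "Laurent polynomials" below are finite sums of monomials $\mathbf t_{\mathcal N}^\beta$, $\beta\in\mathbb Q^{\mathcal N}$, with complex coefficients, and "rational functions" are their quotients; the degree in $t_n$ of a quotient is the degree of the numerator minus that of the denominator (with $\deg 0=-\infty$). Then, for every $h\in H$, the function $f_h(\mathbf t_{\mathcal N})$ is well defined, and there is a unique decomposition $$f_h(\mathbf t_{\mathcal N})=P_h^+(\mathbf t_{\mathcal N})+f_h^{neg}(\mathbf t_{\mathcal N}),$$ where $P_h^+$ is a Laurent polynomial all of whose exponents $\beta$ satisfy $\beta\not<0$, and $f_h^{neg}$ is a rational function with negative degree in $t_n$ for every $n\in\mathcal N$. Moreover, $P_h^+$ has integer coefficients and exponents in $\pi_{\mathcal N}(L')$, and the decomposition comes from a multivariable Euclidean division: there are Laurent polynomials $A,B$ with integer coefficients and exponents in $\pi_{\mathcal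 N}(L')$ such that $f_h(\mathbf t_{\mathcal N})=B/A$, $A$ has a unique maximal monomial term $A_a\mathbf t_{\mathcal N}^a$ with respect to $<$, $a>0$, the division of $B$ by $A$ can be carried out so that it terminates with quotient $P_h^+$ and some remainder $R$, and $f_h^{neg}=R/A$. Here the division starts with $C=R=0$ and repeatedly picks a monomial term $B_b\mathbf t_{\mathcal N}^b$ of the current $B$: if $b\not<a$, it subtracts $\frac{B_b}{A_a}\mathbf t_{\mathcal N}^{b-a}\cdot A$ from $B$ and adds $\frac{B_b}{A_a}\mathbf t_{\mathcal N}^{b-a}$ to the quotient $C$; otherwise it moves the term from $B$ to the remainder $R$. It stops when $B=0$. -/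

import Mathlib

open scoped Classical

noncomputable section

/-- The intersection matrix of a plumbing graph: Euler numbers on the diagonal, adjacency matrix
off the diagonal. -/
def intersectionMatrix {V : Type*} (G : SimpleGraph V) (e : V → ℤ) : Matrix V V ℚ :=
  Matrix.of (fun v w => if v = w then (e v : ℚ) else if G.Adj v w then 1 else 0)

/-- A connected negative definite plumbing graph whose plumbed manifold is a rational homology
sphere: a tree whose vertices are decorated by Euler numbers (all genera are zero), with negative
definite intersection form. -/
structure PlumbingGraph (V : Type*) [Fintype V] where
  graph : SimpleGraph V
  isTree : graph.IsTree
  euler : V → ℤ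
  negDef : ∀ x : V → ℚ, x ≠ 0 → x ⬝ᵥ (intersectionMatrix graph euler).mulVec x < 0

/-- Finite sums of monomials `t^β = ∏ t_i^{β_i}`, `β ∈ ℚ^ι`, with complex coefficients. -/
abbrev LaurentPoly (ι : Type*) : Type _ := AddMonoidAlgebra ℂ (ι → ℚ)

/-- Rational functions in (fractional powers of) the variables `t_i`, `i ∈ ι`. -/
abbrev RatFun (ι : Type*) : Type _ := FractionRing (LaurentPoly ι)

/-- The monomial `t^β`. -/
def monom {ι : Type*} (β : ι → ℚ) : LaurentPoly ι := AddMonoidAlgebra.single β 1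

/-- A Laurent polynomial regarded as a rational function. -/
def toRat {ι : Type*} (P : LaurentPoly ι) : RatFun ι := algebraMap (LaurentPoly ι) (RatFun ι) P

/-- The degree in the variable `t_i` (`⊥` for the zero polynomial). -/
def degreeIn {ι : Type*} (i : ι) (P : LaurentPoly ι) : WithBot ℚ :=
  P.supDegree (fun β => ((β i : ℚ) : WithBot ℚ))

/-- The rational function `g` has negative degree in `t_i`; the degree of a fraction is the degree
of the numerator minus that of the denominator, and `0` has degree `-∞`. -/
def HasNegDegreeIn {ι : Type*} (i : ι) (g : RatFun ι) : Prop :=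
  ∃ B A : LaurentPoly ι, A ≠ 0 ∧ g = toRat B / toRat A ∧ degreeIn i B < degreeIn i A

/-- `f = P + g`, no exponent `β` of `P` satisfies `β < 0` (strict inequality in every coordinate),
and `g` has negative degree in every variable. -/
def IsPolyNegDecomposition {ι : Type*} (f : RatFun ι) (P : LaurentPoly ι) (g : RatFun ι) : Prop :=
  f = toRat P + g ∧ (∀ β ∈ P.coeff.support, ¬ StrongLT β 0) ∧ ∀ i, HasNegDegreeIn i g

/-- `a` is the exponent of the unique maximal monomial term of `A`, for the partial order that
compares all coordinates strictly. -/
def IsUniqueMaxExponent {ι : Type*} (A : LaurentPoly ι) (a : ι → ℚ) : Prop :=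
  a ∈ A.coeff.support ∧ ∀ b ∈ A.coeff.support, b ≠ a → StrongLT b a

/-- One step of the multivariable Euclidean division by `A`, whose maximal exponent is `a`, on
triples `(B, C, R)` (current dividend, quotient, remainder). -/
inductive DivisionStep {ι : Type*} (A : LaurentPoly ι) (a : ι → ℚ) :
    LaurentPoly ι × LaurentPoly ι × LaurentPoly ι →
    LaurentPoly ι × LaurentPoly ι × LaurentPoly ι → Prop
  | quotient (B C R : LaurentPoly ι) (b : ι → ℚ) (hb : b ∈ B.coeff.support)
      (hba : ¬ StrongLT b a) :
      DivisionStep A a (B, C, R)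
        (B - AddMonoidAlgebra.single (b - a) (B.coeff b / A.coeff a) * A,
          C + AddMonoidAlgebra.single (b - a) (B.coeff b / A.coeff a), R)
  | remainder (B C R : LaurentPoly ι) (b : ι → ℚ) (hb : b ∈ B.coeff.support)
      (hba : StrongLT b a) :
      DivisionStep A a (B, C, R)
        (B - AddMonoidAlgebra.single b (B.coeff b), C,
          R + AddMonoidAlgebra.single b (B.coeff b))

/-- Multivariable Euclidean division of `B` by `A` terminates with quotient `C` and
remainder `R`. -/
def EuclideanDivision {ι : Type*} (A : LaurentPoly ι) (a : ι → ℚ) (B C R : LaurentPoly ι) : Prop :=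
  Relation.ReflTransGen (DivisionStep A a) (B, 0, 0) (0, C, R)

/-- `P` has only exponents in the set `S`, and integer coefficients. -/
def IsIntegralOn {ι : Type*} (S : Set (ι → ℚ)) (P : LaurentPoly ι) : Prop :=
  (∀ β ∈ P.coeff.support, β ∈ S) ∧ ∀ β, ∃ z : ℤ, P.coeff β = (z : ℂ)

namespace PlumbingGraph

variable {V : Type*} [Fintype V] (Γ : PlumbingGraph V)

/-- The valency `δ_v`. -/
def valency (v : V) : ℕ := Γ.graph.degree v

/-- The nodes: vertices of valency at least three. -/
abbrev Node : Type _ := {v : V // 3 ≤ Γ.valency v}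

/-- The intersection form in the basis `E_v` of `L ⊗ ℚ = ℚ^V`. -/
def form : Matrix V V ℚ := intersectionMatrix Γ.graph Γ.euler

/-- The lattice `L`, inside `L ⊗ ℚ`. -/
def lattice (_Γ : PlumbingGraph V) : AddSubgroup (V → ℚ) where
  carrier := {l | ∀ v, ∃ z : ℤ, l v = z}
  zero_mem' := fun _ => ⟨0, by simp⟩
  add_mem' := by
    intro a b ha hb v
    obtain ⟨x, hx⟩ := ha v
    obtain ⟨y, hy⟩ := hb v
    exact ⟨x + y, by simp [hx, hy]⟩
  neg_mem' := by
    intro a ha v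
    obtain ⟨x, hx⟩ := ha v
    exact ⟨-x, by simp [hx]⟩

/-- The dual lattice `L'`: all `l ∈ L ⊗ ℚ` with integral intersection numbers `(l, E_v)`. -/
def dualLattice : AddSubgroup (V → ℚ) where
  carrier := {l | ∀ v, ∃ z : ℤ, Γ.form.mulVec l v = z}
  zero_mem' := fun _ => ⟨0, by simp⟩
  add_mem' := by
    intro a b ha hb v
    obtain ⟨x, hx⟩ := ha v
    obtain ⟨y, hy⟩ := hb v
    exact ⟨x + y, by simp [Matrix.mulVec_add, hx, hy]⟩
  neg_mem' := by
    intro a ha v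
    obtain ⟨x, hx⟩ := ha v
    exact ⟨-x, by simp [Matrix.mulVec_neg, hx]⟩

/-- The group `H = L'/L`. -/
abbrev H : Type _ := Γ.dualLattice ⧸ Γ.lattice.addSubgroupOf Γ.dualLattice

/-- `l` lies in `L'` and has class `[l] = h`. -/
def HasClass (l : V → ℚ) (h : Γ.H) : Prop :=
  ∃ hl : l ∈ Γ.dualLattice, ((⟨l, hl⟩ : Γ.dualLattice) : Γ.H) = h

/-- The anti-dual `E_v^*`, defined by `(E_v^*, E_w) = -δ_{vw}`. -/
def dualVec (v : V) : V → ℚ := fun w => -(Γ.form⁻¹ w v)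

/-- The multivariable zeta-function `f(t) = ∏_v (1 - t^{E_v^*})^{δ_v - 2}`. -/
def zeta : RatFun V :=
  ∏ v, (1 - toRat (monom (Γ.dualVec v))) ^ ((Γ.valency v : ℤ) - 2)

/-- The substitution `x_v ↦ t^{E_v^*}`. -/
def substDual (A : MvPolynomial V ℂ) : LaurentPoly V :=
  MvPolynomial.aeval (fun v => monom (Γ.dualVec v)) A

/-- The series `∑_k S_k t^{∑ k_v E_v^*}`, supported on the Lipman cone (freely generated by the
`E_v^*`), is the Taylor expansion at the origin of the rational function `F(t)`. Series on the
Lipman cone are written as power series `S` in the variables `x_v = t^{E_v^*}`. -/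
def IsTaylorExpansion (F : RatFun V) (S : MvPowerSeries V ℂ) : Prop :=
  ∃ A B : MvPolynomial V ℂ, A ≠ 0 ∧
    (A : MvPowerSeries V ℂ) * S = (B : MvPowerSeries V ℂ) ∧
    F = toRat (Γ.substDual B) / toRat (Γ.substDual A)

/-- The part `∑_{[l'] = h} p_{l'} t^{l'}` of a series `∑ p_{l'} t^{l'}`. -/
def seriesPart (h : Γ.H) (S : MvPowerSeries V ℂ) : MvPowerSeries V ℂ :=
  fun k => if Γ.HasClass (∑ v, k v • Γ.dualVec v) h then MvPowerSeries.coeff k S else 0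

/-- `F` is the `h`-equivariant part `f_h(t)` of the zeta-function: the rational function whose
Taylor expansion is the `h`-part `Z_h` of the Taylor expansion `Z` of `f`. -/
def IsEquivariantPart (h : Γ.H) (F : RatFun V) : Prop :=
  ∃ Z : MvPowerSeries V ℂ, Γ.IsTaylorExpansion Γ.zeta Z ∧
    Γ.IsTaylorExpansion F (Γ.seriesPart h Z)

/-- The projection `π_N` onto the coordinates of the nodes. -/
def proj : (V → ℚ) →+ (Γ.Node → ℚ) where
  toFun l := fun n => l n.1
  map_zero' := rfl
  map_add' _ _ := rfl

/-- Setting `t_v = 1` for all `v` that are not nodes, in a Laurent polynomial. -/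
def specialize : LaurentPoly V →+* LaurentPoly Γ.Node :=
  AddMonoidAlgebra.mapDomainRingHom ℂ Γ.proj

/-- `f` is obtained from the rational function `F` by setting `t_v = 1` for all `v` that are not
nodes: `F` is a fraction whose denominator does not vanish identically there. -/
def IsSpecialization (F : RatFun V) (f : RatFun Γ.Node) : Prop :=
  ∃ A B : LaurentPoly V, Γ.specialize A ≠ 0 ∧ F = toRat B / toRat A ∧
    f = toRat (Γ.specialize B) / toRat (Γ.specialize A)

/-- `f` is the reduced zeta-function `f_h(t_N) = f_h(t)|_{t_v = 1, v ∉ N}`. -/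
def IsReducedZeta (h : Γ.H) (f : RatFun Γ.Node) : Prop :=
  ∃ F : RatFun V, Γ.IsEquivariantPart h F ∧ Γ.IsSpecialization F f

/-- The projected lattice `π_N(L')`. -/
def projDualLattice : Set (Γ.Node → ℚ) := Γ.proj '' (Γ.dualLattice : Set (V → ℚ))

end PlumbingGraph

end

/-! Negative definiteness and connectedness force every `E_v^*` to have strictly positive
coordinates (`dualVec_pos`). Choose `d_v > 0` with `d_v E_v^* ∈ L` and write `x_v = t^{E_v^*}`.
Multiplication by `1 - x_v^{d_v}` commutes with taking the part of class `h`. Since `δ_v - 2 ≥ -2`,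
the product `D = ∏ (1 - x_v^{d_v})^2` turns `Z` into a polynomial `N` with integer coefficients, so
`Z_h` is the `h`-part of `N` divided by `D` (`isReducedZeta`).

By positivity `D` stays nonzero after setting `t_v = 1` off the nodes. Its image has the unique
maximal exponent `a = ∑ 2 d_v π(E_v^*)`, and the squares make the leading coefficient `1`, so
division by it keeps coefficients integral. A quotient step lowers exponents by a fixed gap in every
coordinate, hence division terminates (`exists_division_from`). The remainder has exponents `< a`,
hence negative degree over `A` in each variable.

For uniqueness, the difference of two polynomial parts is a Laurent polynomial of negative degree in
every variable. All its exponents are then `< 0`, which neither part allows, so it vanishes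
(`IsPolyNegDecomposition.unique`). -/

section Laurent

variable {ι : Type*}

/-! ### Laurent polynomials inside rational functions -/

@[simp] theorem toRat_zero : toRat (0 : LaurentPoly ι) = 0 := map_zero _
@[simp] theorem toRat_one : toRat (1 : LaurentPoly ι) = 1 := map_one _
theorem toRat_add (P Q : LaurentPoly ι) : toRat (P + Q) = toRat P + toRat Q := map_add _ _ _
theorem toRat_sub (P Q : LaurentPoly ι) : toRat (P - Q) = toRat P - toRat Q := map_sub _ _ _
theorem toRat_mul (P Q : LaurentPoly ι) : toRat (P * Q) = toRat P * toRat Q := map_mul _ _ _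
theorem toRat_pow (P : LaurentPoly ι) (n : ℕ) : toRat (P ^ n) = toRat P ^ n := map_pow _ _ _
theorem toRat_prod {κ : Type*} (s : Finset κ) (P : κ → LaurentPoly ι) :
    toRat (∏ k ∈ s, P k) = ∏ k ∈ s, toRat (P k) := map_prod (algebraMap _ (RatFun ι)) _ _

theorem toRat_injective : Function.Injective (toRat : LaurentPoly ι → RatFun ι) :=
  IsFractionRing.injective _ _

theorem toRat_ne_zero {P : LaurentPoly ι} (hP : P ≠ 0) : toRat P ≠ 0 := fun h =>
  hP (toRat_injective (h.trans toRat_zero.symm))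

/-- Equality of fractions by cross multiplication. -/
theorem toRat_div_eq_div_iff {A B A' B' : LaurentPoly ι} (hA : A ≠ 0) (hA' : A' ≠ 0) :
    toRat B / toRat A = toRat B' / toRat A' ↔ B * A' = B' * A := by
  rw [div_eq_div_iff (toRat_ne_zero hA) (toRat_ne_zero hA'), ← toRat_mul, ← toRat_mul,
    toRat_injective.eq_iff]

theorem monom_zero : monom (0 : ι → ℚ) = 1 := rfl

theorem monom_nsmul (n : ℕ) (β : ι → ℚ) : monom (n • β) = monom β ^ n := by
  simp [monom, AddMonoidAlgebra.single_pow]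

/-! ### Degrees -/

theorem degreeIn_le_iff {i : ι} {P : LaurentPoly ι} {d : WithBot ℚ} :
    degreeIn i P ≤ d ↔ ∀ β ∈ P.coeff.support, ((β i : ℚ) : WithBot ℚ) ≤ d :=
  Finset.sup_le_iff

theorem le_degreeIn {i : ι} {P : LaurentPoly ι} {β : ι → ℚ} (hβ : β ∈ P.coeff.support) :
    ((β i : ℚ) : WithBot ℚ) ≤ degreeIn i P :=
  degreeIn_le_iff.1 le_rfl β hβ

theorem exists_degreeIn_eq (i : ι) {P : LaurentPoly ι} (hP : P ≠ 0) :
    ∃ β ∈ P.coeff.support, degreeIn i P = ((β i : ℚ) : WithBot ℚ) :=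
  AddMonoidAlgebra.exists_supDegree_mem_support _ hP

@[simp] theorem degreeIn_zero (i : ι) : degreeIn i (0 : LaurentPoly ι) = ⊥ :=
  AddMonoidAlgebra.supDegree_zero

theorem degreeIn_ne_bot (i : ι) {P : LaurentPoly ι} (hP : P ≠ 0) : degreeIn i P ≠ ⊥ := by
  obtain ⟨β, -, h⟩ := exists_degreeIn_eq i hP
  simp [h]

/-- Many exponents can share the top `i`-th coordinate, so the top terms might seem to cancel.
Unique sums in `ℚ^ι`, applied to the two top faces, give a product monomial that arises only once
and survives. -/
theorem degreeIn_mul (i : ι) (P Q : LaurentPoly ι) :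
    degreeIn i (P * Q) = degreeIn i P + degreeIn i Q := by
  by_cases hP : P = 0
  · simp [hP]
  by_cases hQ : Q = 0
  · simp [hQ]
  refine le_antisymm (AddMonoidAlgebra.supDegree_mul_le fun a b => by simp) ?_
  obtain ⟨β, hβ, hPβ⟩ := exists_degreeIn_eq i hP
  obtain ⟨γ, hγ, hQγ⟩ := exists_degreeIn_eq i hQ
  have hle : ∀ b ∈ P.coeff.support, b i ≤ β i := fun b hb => by
    have := le_degreeIn (i := i) hb
    rw [hPβ] at this
    exact_mod_cast this
  have hle' : ∀ b ∈ Q.coeff.support, b i ≤ γ i := fun b hb => by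
    have := le_degreeIn (i := i) hb
    rw [hQγ] at this
    exact_mod_cast this
  obtain ⟨b, hb, c, hc, hu⟩ := UniqueSums.uniqueAdd_of_nonempty
    (A := {b ∈ P.coeff.support | b i = β i}) (B := {c ∈ Q.coeff.support | c i = γ i})
    ⟨β, by simp [Finsupp.mem_support_iff.1 hβ]⟩ ⟨γ, by simp [Finsupp.mem_support_iff.1 hγ]⟩
  rw [Finset.mem_filter] at hb hc
  -- A sum reaching the top `i`-th coordinate can only come from the two top faces, so uniqueness
  -- there gives uniqueness in the full supports.
  have hu' : UniqueAdd P.coeff.support Q.coeff.support b c := by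
    intro b' c' hb' hc' h
    have hi := congrFun h i
    simp only [Pi.add_apply] at hi
    have h1 := hle b' hb'
    have h2 := hle' c' hc'
    refine hu (Finset.mem_filter.2 ⟨hb', ?_⟩) (Finset.mem_filter.2 ⟨hc', ?_⟩) h <;>
      linarith [hb.2, hc.2]
  have hmem : b + c ∈ (P * Q).coeff.support := by
    rw [Finsupp.mem_support_iff, AddMonoidAlgebra.coeff_mul_add_of_uniqueAdd hu']
    exact mul_ne_zero (Finsupp.mem_support_iff.1 hb.1) (Finsupp.mem_support_iff.1 hc.1)
  have := le_degreeIn (i := i) hmem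
  rwa [Pi.add_apply, hb.2, hc.2, WithBot.coe_add, ← hPβ, ← hQγ] at this

theorem HasNegDegreeIn.sub {i : ι} {g g' : RatFun ι} (hg : HasNegDegreeIn i g)
    (hg' : HasNegDegreeIn i g') : HasNegDegreeIn i (g - g') := by
  obtain ⟨B, A, hA, rfl, hlt⟩ := hg
  obtain ⟨B', A', hA', rfl, hlt'⟩ := hg'
  refine ⟨B * A' - A * B', A * A', mul_ne_zero hA hA', ?_, ?_⟩
  · rw [div_sub_div _ _ (toRat_ne_zero hA) (toRat_ne_zero hA')]
    simp only [toRat_mul, toRat_sub]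
  · refine (AddMonoidAlgebra.supDegree_sub_le).trans_lt (max_lt ?_ ?_)
    · change degreeIn i (B * A') < degreeIn i (A * A')
      rw [degreeIn_mul, degreeIn_mul]
      exact WithBot.add_lt_add_right (degreeIn_ne_bot i hA') hlt
    · change degreeIn i (A * B') < degreeIn i (A * A')
      rw [degreeIn_mul, degreeIn_mul]
      exact WithBot.add_lt_add_left (degreeIn_ne_bot i hA) hlt'

/-- Additivity of the degree makes the chosen fraction irrelevant: `P * A = B` and `deg B < deg A`
force `deg P < 0`. -/
theorem HasNegDegreeIn.exponent_neg {i : ι} {P : LaurentPoly ι} (h : HasNegDegreeIn i (toRat P))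
    {β : ι → ℚ} (hβ : β ∈ P.coeff.support) : β i < 0 := by
  obtain ⟨B, A, hA, hPA, hlt⟩ := h
  have hB : P * A = B := by
    rw [eq_div_iff (toRat_ne_zero hA), ← toRat_mul] at hPA
    exact toRat_injective hPA
  rw [← hB, degreeIn_mul] at hlt
  by_contra! hβi
  refine hlt.not_ge ?_
  calc degreeIn i A = 0 + degreeIn i A := (zero_add _).symm
    _ ≤ degreeIn i P + degreeIn i A := by
      gcongr
      exact le_trans (by exact_mod_cast hβi) (le_degreeIn hβ)

/-! ### Uniqueness of the decomposition -/

theorem IsPolyNegDecomposition.unique {f : RatFun ι} {P P' : LaurentPoly ι} {g g' : RatFun ι}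
    (h : IsPolyNegDecomposition f P g) (h' : IsPolyNegDecomposition f P' g') :
    P = P' ∧ g = g' := by
  have hsub : toRat (P - P') = g' - g := by
    rw [toRat_sub, sub_eq_sub_iff_add_eq_add, ← h.1, h'.1, add_comm]
  have hP : P - P' = 0 := by
    by_contra hne
    obtain ⟨β, hβ⟩ := Finsupp.support_nonempty_iff.2 (mt AddMonoidAlgebra.coeff_eq_zero.1 hne)
    have hneg : StrongLT β 0 := fun i =>
      HasNegDegreeIn.exponent_neg (hsub ▸ (h'.2.2 i).sub (h.2.2 i)) hβ
    rw [AddMonoidAlgebra.coeff_sub] at hβ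
    rcases Finset.mem_union.1 (Finsupp.support_sub hβ) with hβ | hβ
    · exact h.2.1 β hβ hneg
    · exact h'.2.1 β hβ hneg
  refine ⟨sub_eq_zero.1 hP, ?_⟩
  rw [hP, toRat_zero, eq_comm, sub_eq_zero] at hsub
  exact hsub.symm

/-! ### Integrality -/

theorem isIntegralOn_single {S : AddSubgroup (ι → ℚ)} {β : ι → ℚ} (hβ : β ∈ S) (z : ℤ) :
    IsIntegralOn (S : Set (ι → ℚ)) (AddMonoidAlgebra.single β (z : ℂ)) := by
  refine ⟨fun γ hγ => ?_, fun γ => ?_⟩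
  · rw [AddMonoidAlgebra.coeff_single] at hγ
    rw [Finset.mem_singleton.1 (Finsupp.support_single_subset hγ)]
    exact hβ
  · rw [AddMonoidAlgebra.coeff_single, Finsupp.single_apply]
    split_ifs
    exacts [⟨z, rfl⟩, ⟨0, by simp⟩]

theorem IsIntegralOn.zero (S : Set (ι → ℚ)) : IsIntegralOn S 0 :=
  ⟨by simp, fun _ => ⟨0, by simp⟩⟩

theorem IsIntegralOn.add {S : Set (ι → ℚ)} {P Q : LaurentPoly ι} (hP : IsIntegralOn S P)
    (hQ : IsIntegralOn S Q) : IsIntegralOn S (P + Q) := by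
  refine ⟨fun β hβ => ?_, fun β => ?_⟩
  · rw [AddMonoidAlgebra.coeff_add] at hβ
    rcases Finset.mem_union.1 (Finsupp.support_add hβ) with h | h
    exacts [hP.1 β h, hQ.1 β h]
  · obtain ⟨x, hx⟩ := hP.2 β
    obtain ⟨y, hy⟩ := hQ.2 β
    exact ⟨x + y, by simp [hx, hy]⟩

theorem IsIntegralOn.neg {S : Set (ι → ℚ)} {P : LaurentPoly ι} (hP : IsIntegralOn S P) :
    IsIntegralOn S (-P) := by
  refine ⟨fun β hβ => hP.1 β (by simpa using hβ), fun β => ?_⟩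
  obtain ⟨x, hx⟩ := hP.2 β
  exact ⟨-x, by simp [hx]⟩

theorem IsIntegralOn.sub {S : Set (ι → ℚ)} {P Q : LaurentPoly ι} (hP : IsIntegralOn S P)
    (hQ : IsIntegralOn S Q) : IsIntegralOn S (P - Q) :=
  sub_eq_add_neg P Q ▸ hP.add hQ.neg

theorem IsIntegralOn.sum {κ : Type*} {S : Set (ι → ℚ)} (s : Finset κ) {P : κ → LaurentPoly ι}
    (hP : ∀ k ∈ s, IsIntegralOn S (P k)) : IsIntegralOn S (∑ k ∈ s, P k) :=
  Finset.sum_induction _ _ (fun _ _ => IsIntegralOn.add) (.zero S) hP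

theorem IsIntegralOn.mul {S : AddSubgroup (ι → ℚ)} {P Q : LaurentPoly ι}
    (hP : IsIntegralOn (S : Set (ι → ℚ)) P) (hQ : IsIntegralOn (S : Set (ι → ℚ)) Q) :
    IsIntegralOn (S : Set (ι → ℚ)) (P * Q) := by
  rw [AddMonoidAlgebra.mul_def]
  refine IsIntegralOn.sum _ fun b hb => IsIntegralOn.sum _ fun c hc => ?_
  obtain ⟨x, hx⟩ := hP.2 b
  obtain ⟨y, hy⟩ := hQ.2 c
  dsimp only
  rw [hx, hy, ← Int.cast_mul]
  exact isIntegralOn_single (S.add_mem (hP.1 b hb) (hQ.1 c hc)) _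

theorem isIntegralOn_monom {S : AddSubgroup (ι → ℚ)} {β : ι → ℚ} (hβ : β ∈ S) :
    IsIntegralOn (S : Set (ι → ℚ)) (monom β) := by
  simpa [monom] using isIntegralOn_single hβ 1

theorem isIntegralOn_one (S : AddSubgroup (ι → ℚ)) : IsIntegralOn (S : Set (ι → ℚ)) 1 :=
  isIntegralOn_monom S.zero_mem

theorem IsIntegralOn.prod {κ : Type*} {S : AddSubgroup (ι → ℚ)} (s : Finset κ)
    {P : κ → LaurentPoly ι} (hP : ∀ k ∈ s, IsIntegralOn (S : Set (ι → ℚ)) (P k)) :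
    IsIntegralOn (S : Set (ι → ℚ)) (∏ k ∈ s, P k) :=
  Finset.prod_induction _ _ (fun _ _ => IsIntegralOn.mul) (isIntegralOn_one S) hP

theorem IsIntegralOn.pow {S : AddSubgroup (ι → ℚ)} {P : LaurentPoly ι}
    (hP : IsIntegralOn (S : Set (ι → ℚ)) P) (n : ℕ) :
    IsIntegralOn (S : Set (ι → ℚ)) (P ^ n) := by
  rw [← Fin.prod_const]
  exact IsIntegralOn.prod _ fun _ _ => hP

/-! ### Euclidean division -/

/-- Leading exponents add up and leading coefficients multiply. -/
theorem IsUniqueMaxExponent.mul {P Q : LaurentPoly ι} {a b : ι → ℚ}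
    (hP : IsUniqueMaxExponent P a) (hQ : IsUniqueMaxExponent Q b) :
    IsUniqueMaxExponent (P * Q) (a + b) ∧
      (P * Q).coeff (a + b) = P.coeff a * Q.coeff b := by
  have hle : ∀ p ∈ P.coeff.support, p ≤ a := fun p hp => by
    by_cases h : p = a
    exacts [h.le, (hP.2 p hp h).le]
  have hle' : ∀ p ∈ Q.coeff.support, p ≤ b := fun p hp => by
    by_cases h : p = b
    exacts [h.le, (hQ.2 p hp h).le]
  -- Both exponents are coordinatewise maxima, so `a + b` is attained by one pair only.
  have hu : UniqueAdd P.coeff.support Q.coeff.support a b := fun p q hp hq h => by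
    have h1 := hle p hp
    have h2 := hle' q hq
    constructor <;> funext i <;> have := congrFun h i <;> have := h1 i <;> have := h2 i <;>
      simp only [Pi.add_apply] at * <;> linarith
  have hc := AddMonoidAlgebra.coeff_mul_add_of_uniqueAdd hu
  refine ⟨⟨?_, fun c hc' hne => ?_⟩, hc⟩
  · rw [Finsupp.mem_support_iff, hc]
    exact mul_ne_zero (Finsupp.mem_support_iff.1 hP.1) (Finsupp.mem_support_iff.1 hQ.1)
  · obtain ⟨p, hp, q, hq, rfl⟩ :=
      Finset.mem_add.1 (AddMonoidAlgebra.support_coeff_mul_subset P Q hc')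
    intro i
    by_cases hpa : p = a
    · have hqb : q ≠ b := fun h => hne (by rw [hpa, h])
      simpa [hpa] using hQ.2 q hq hqb i
    · exact add_lt_add_of_lt_of_le (hP.2 p hp hpa i) (hle' q hq i)

theorem exists_pos_gap [Finite ι] {A : LaurentPoly ι} {a : ι → ℚ}
    (hA : IsUniqueMaxExponent A a) :
    ∃ ε : ℚ, 0 < ε ∧ ∀ c ∈ A.coeff.support, c ≠ a → ∀ i, c i + ε ≤ a i := by
  have := Fintype.ofFinite ι
  -- The `1` keeps the set of gaps nonempty when `A` is a single monomial or there are no variables.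
  let T : Finset ℚ := insert 1
    (((A.coeff.support.erase a) ×ˢ Finset.univ).image fun p : (ι → ℚ) × ι => a p.2 - p.1 p.2)
  have hT : T.Nonempty := ⟨1, by simp [T]⟩
  refine ⟨T.min' hT, ?_, fun c hc hca i => ?_⟩
  · rw [Finset.lt_min'_iff]
    intro t ht
    rcases Finset.mem_insert.1 ht with rfl | ht
    · exact one_pos
    · obtain ⟨⟨c, i⟩, hci, rfl⟩ := Finset.mem_image.1 ht
      simp only [Finset.mem_product, Finset.mem_erase] at hci
      exact sub_pos.2 (hA.2 c hci.1.2 hci.1.1 i)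
  · have : T.min' hT ≤ a i - c i := Finset.min'_le _ _ <| Finset.mem_insert_of_mem <|
      Finset.mem_image.2 ⟨(c, i), by
        rw [Finset.mem_product, Finset.mem_erase]; exact ⟨⟨hca, hc⟩, Finset.mem_univ _⟩, rfl⟩
    linarith

/-- A rank function on exponents which drops whenever a quotient step of the Euclidean division
replaces an exponent by new ones. -/
theorem exists_division_rank [Finite ι] {A : LaurentPoly ι} {a : ι → ℚ}
    (hA : IsUniqueMaxExponent A a) :
    ∃ μ : (ι → ℚ) → ℕ, ∀ b, ¬ StrongLT b a → ∀ c ∈ A.coeff.support, c ≠ a →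
      μ (b - a + c) < μ b := by
  have := Fintype.ofFinite ι
  obtain ⟨ε, hε, hgap⟩ := exists_pos_gap hA
  -- The rank measures, in units of the gap `ε`, how far `b` exceeds `a` in its worst coordinate.
  -- The `+ 1` makes it positive exactly when `b` is not `< a`, so there is room to drop.
  refine ⟨fun b => Finset.univ.sup fun i => ⌊(b i - a i) / ε + 1⌋₊, fun b hb c hc hca => ?_⟩
  have hpos : 0 < Finset.univ.sup fun i => ⌊(b i - a i) / ε + 1⌋₊ := by
    simp only [StrongLT, not_forall, not_lt] at hb
    obtain ⟨i, hi⟩ := hb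
    refine lt_of_lt_of_le ?_ (Finset.le_sup (Finset.mem_univ i))
    rw [Nat.floor_pos]
    have : 0 ≤ (b i - a i) / ε := div_nonneg (sub_nonneg.2 hi) hε.le
    linarith
  refine (Finset.sup_lt_iff hpos).2 fun i _ => ?_
  have hstep : ((b - a + c) i - a i) / ε + 1 ≤ (b i - a i) / ε + 1 - 1 := by
    have h1 : ((b - a + c) i - a i) ≤ (b i - a i) - ε := by
      have := hgap c hc hca i
      simp only [Pi.add_apply, Pi.sub_apply]
      linarith
    have h2 := div_le_div_of_nonneg_right h1 hε.le
    rw [sub_div (b i - a i), div_self hε.ne'] at h2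
    linarith
  have h1 : ⌊((b - a + c) i - a i) / ε + 1⌋₊ ≤ ⌊(b i - a i) / ε + 1⌋₊ - 1 := by
    rw [← Nat.floor_sub_one]
    exact Nat.floor_mono hstep
  have h2 : ⌊(b i - a i) / ε + 1⌋₊ ≤ Finset.univ.sup fun i => ⌊(b i - a i) / ε + 1⌋₊ :=
    Finset.le_sup (f := fun i => ⌊(b i - a i) / ε + 1⌋₊) (Finset.mem_univ i)
  omega

/-- The leading term of the subtracted multiple cancels the term at `b`; only translates of the
lower exponents of `A` can enter. -/
theorem support_quotient_step_subset {A B : LaurentPoly ι} {a b : ι → ℚ}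
    (ha : A.coeff a ≠ 0) :
    (B - AddMonoidAlgebra.single (b - a) (B.coeff b / A.coeff a) * A).coeff.support ⊆
      B.coeff.support.erase b ∪ (A.coeff.support.erase a).image fun c => b - a + c := by
  intro d hd
  rw [Finsupp.mem_support_iff, AddMonoidAlgebra.coeff_sub, Finsupp.sub_apply,
    AddMonoidAlgebra.coeff_single_mul_apply] at hd
  by_cases hdb : d = b
  · subst hdb
    exact absurd (by rw [neg_sub, sub_add_cancel, div_mul_cancel₀ _ ha, sub_self]) hd
  by_cases hB : B.coeff d = 0
  · refine Finset.mem_union_right _ (Finset.mem_image.2 ⟨-(b - a) + d, ?_, by abel⟩)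
    refine Finset.mem_erase.2 ⟨fun h => hdb ?_, ?_⟩
    · have : d = (b - a) + (-(b - a) + d) := by abel
      rw [this, h]; abel
    · rw [Finsupp.mem_support_iff]
      intro h
      exact hd (by rw [hB, h, mul_zero, sub_zero])
  · exact Finset.mem_union_left _ (Finset.mem_erase.2 ⟨hdb, Finsupp.mem_support_iff.2 hB⟩)

theorem support_remainder_step_subset (B : LaurentPoly ι) (b : ι → ℚ) :
    (B - AddMonoidAlgebra.single b (B.coeff b)).coeff.support ⊆ B.coeff.support.erase b := by
  intro d hd
  rw [Finsupp.mem_support_iff, AddMonoidAlgebra.coeff_sub, Finsupp.sub_apply,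
    AddMonoidAlgebra.coeff_single, Finsupp.single_apply] at hd
  rw [Finset.mem_erase, Finsupp.mem_support_iff]
  split_ifs at hd with h
  · simp [h] at hd
  · exact ⟨Ne.symm h, by simpa using hd⟩

/-- The sum of `K ^ μ b` over the exponents `b` of `B`. -/
def divisionWeight (K : ℕ) (μ : (ι → ℚ) → ℕ) (B : LaurentPoly ι) : ℕ :=
  ∑ b ∈ B.coeff.support, K ^ μ b

theorem divisionWeight_remainder_step_lt {K : ℕ} (hK : 0 < K) (μ : (ι → ℚ) → ℕ)
    {B : LaurentPoly ι} {b : ι → ℚ} (hb : b ∈ B.coeff.support) :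
    divisionWeight K μ (B - AddMonoidAlgebra.single b (B.coeff b)) < divisionWeight K μ B := by
  refine (Finset.sum_le_sum_of_subset (support_remainder_step_subset B b)).trans_lt ?_
  rw [divisionWeight, ← Finset.sum_erase_add _ _ hb]
  exact Nat.lt_add_of_pos_right (pow_pos hK _)

/-- With `K` terms in `A`, an exponent of rank `m` is traded for at most `K - 1` exponents of rank
at most `m - 1`, and `(K - 1) K^(m-1) < K^m`. -/
theorem divisionWeight_quotient_step_lt {A B : LaurentPoly ι} {a b : ι → ℚ}
    (hA : a ∈ A.coeff.support) {μ : (ι → ℚ) → ℕ}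
    (hμ : ∀ c ∈ A.coeff.support, c ≠ a → μ (b - a + c) < μ b) (hb : b ∈ B.coeff.support) :
    divisionWeight A.coeff.support.card μ
        (B - AddMonoidAlgebra.single (b - a) (B.coeff b / A.coeff a) * A) <
      divisionWeight A.coeff.support.card μ B := by
  set K := A.coeff.support.card with hKdef
  have hK : 0 < K := Finset.card_pos.2 ⟨a, hA⟩
  set T := (A.coeff.support.erase a).image fun c => b - a + c
  have hT : ∑ d ∈ T, K ^ μ d < K ^ μ b := by
    -- In rank zero nothing can have smaller rank, so `A` is a monomial and no new exponent appears.
    -- This case is separate because `μ b - 1` truncates.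
    by_cases hm : μ b = 0
    · have : T = ∅ := by
        rw [Finset.image_eq_empty, Finset.eq_empty_iff_forall_notMem]
        intro c hc
        rw [Finset.mem_erase] at hc
        have := hμ c hc.2 hc.1
        omega
      rw [this, Finset.sum_empty]
      exact pow_pos hK _
    · calc ∑ d ∈ T, K ^ μ d ≤ T.card • K ^ (μ b - 1) := by
            refine Finset.sum_le_card_nsmul _ _ _ fun d hd => ?_
            obtain ⟨c, hc, rfl⟩ := Finset.mem_image.1 hd
            rw [Finset.mem_erase] at hc
            have := hμ c hc.2 hc.1
            exact Nat.pow_le_pow_right hK (by omega)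
        _ ≤ (K - 1) * K ^ (μ b - 1) := by
            rw [smul_eq_mul]
            refine Nat.mul_le_mul_right _ (Finset.card_image_le.trans ?_)
            rw [Finset.card_erase_of_mem hA]
        _ < K * K ^ (μ b - 1) := Nat.mul_lt_mul_of_pos_right (by omega) (pow_pos hK _)
        _ = K ^ μ b := by rw [← pow_succ']; congr 1; omega
  calc divisionWeight K μ (B - AddMonoidAlgebra.single (b - a) (B.coeff b / A.coeff a) * A)
      ≤ ∑ d ∈ B.coeff.support.erase b ∪ T, K ^ μ d :=
        Finset.sum_le_sum_of_subset
          (support_quotient_step_subset (Finsupp.mem_support_iff.1 hA))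
    _ ≤ ∑ d ∈ B.coeff.support.erase b, K ^ μ d + ∑ d ∈ T, K ^ μ d := by
        rw [← Finset.sum_union_inter]
        exact Nat.le_add_right _ _
    _ < ∑ d ∈ B.coeff.support.erase b, K ^ μ d + K ^ μ b := Nat.add_lt_add_left hT _
    _ = divisionWeight K μ B := Finset.sum_erase_add _ _ hb

/-- Induction on the weight needs an arbitrary intermediate state; `B + C * A + R` is the invariant
of both kinds of step. Leading coefficient `1` keeps the quotients integral. -/
theorem exists_division_from [Finite ι] {A : LaurentPoly ι} {a : ι → ℚ}
    (hA : IsUniqueMaxExponent A a) (hAa : A.coeff a = 1) {S : AddSubgroup (ι → ℚ)}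
    (hAS : IsIntegralOn (S : Set (ι → ℚ)) A) (B C R : LaurentPoly ι)
    (hB : IsIntegralOn (S : Set (ι → ℚ)) B) (hC : IsIntegralOn (S : Set (ι → ℚ)) C)
    (hC0 : ∀ β ∈ C.coeff.support, ¬ StrongLT β 0) (hR : ∀ β ∈ R.coeff.support, StrongLT β a) :
    ∃ C' R' : LaurentPoly ι,
      Relation.ReflTransGen (DivisionStep A a) (B, C, R) (0, C', R') ∧
      IsIntegralOn (S : Set (ι → ℚ)) C' ∧ (∀ β ∈ C'.coeff.support, ¬ StrongLT β 0) ∧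
      (∀ β ∈ R'.coeff.support, StrongLT β a) ∧ B + C * A + R = C' * A + R' := by
  obtain ⟨μ, hμ⟩ := exists_division_rank hA
  induction hn : divisionWeight A.coeff.support.card μ B using Nat.strong_induction_on
    generalizing B C R with
  | _ n ih =>
  by_cases hB0 : B = 0
  · subst hB0
    exact ⟨C, R, .refl, hC, hC0, hR, by rw [zero_add]⟩
  obtain ⟨b, hb⟩ := Finsupp.support_nonempty_iff.2 (mt AddMonoidAlgebra.coeff_eq_zero.1 hB0)
  have haS : a ∈ S := hAS.1 a hA.1
  have hbS : b ∈ S := hB.1 b hb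
  obtain ⟨z, hz⟩ := hB.2 b
  by_cases hba : StrongLT b a
  · obtain ⟨C', R', h1, h2, h3, h4, h5⟩ := ih _
      (hn ▸ divisionWeight_remainder_step_lt (Finset.card_pos.2 ⟨a, hA.1⟩) μ hb)
      (B - AddMonoidAlgebra.single b (B.coeff b)) C (R + AddMonoidAlgebra.single b (B.coeff b))
      (hB.sub (hz ▸ isIntegralOn_single hbS z)) hC hC0
      (fun β hβ => by
        rw [AddMonoidAlgebra.coeff_add] at hβ
        rcases Finset.mem_union.1 (Finsupp.support_add hβ) with hβ | hβ
        · exact hR β hβ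
        · rw [AddMonoidAlgebra.coeff_single] at hβ
          rw [Finset.mem_singleton.1 (Finsupp.support_single_subset hβ)]
          exact hba) rfl
    exact ⟨C', R', .head (.remainder B C R b hb hba) h1, h2, h3, h4, by rw [← h5]; ring⟩
  · have hq : IsIntegralOn (S : Set (ι → ℚ))
        (AddMonoidAlgebra.single (b - a) (B.coeff b / A.coeff a)) := by
      rw [hAa, div_one, hz]
      exact isIntegralOn_single (S.sub_mem hbS haS) z
    obtain ⟨C', R', h1, h2, h3, h4, h5⟩ := ih _
      (hn ▸ divisionWeight_quotient_step_lt hA.1 (hμ b hba) hb)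
      (B - AddMonoidAlgebra.single (b - a) (B.coeff b / A.coeff a) * A)
      (C + AddMonoidAlgebra.single (b - a) (B.coeff b / A.coeff a)) R
      (hB.sub (hq.mul hAS)) (hC.add hq)
      (fun β hβ => by
        rw [AddMonoidAlgebra.coeff_add] at hβ
        rcases Finset.mem_union.1 (Finsupp.support_add hβ) with hβ | hβ
        · exact hC0 β hβ
        · rw [AddMonoidAlgebra.coeff_single] at hβ
          rw [Finset.mem_singleton.1 (Finsupp.support_single_subset hβ)]
          exact fun h => hba fun i => sub_neg.1 (h i)) hR rfl
    exact ⟨C', R', .head (.quotient B C R b hb hba) h1, h2, h3, h4, by rw [← h5]; ring⟩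

theorem IsUniqueMaxExponent.degreeIn_eq {A : LaurentPoly ι} {a : ι → ℚ}
    (hA : IsUniqueMaxExponent A a) (i : ι) : degreeIn i A = ((a i : ℚ) : WithBot ℚ) := by
  refine le_antisymm (degreeIn_le_iff.2 fun b hb => ?_) (le_degreeIn hA.1)
  by_cases h : b = a
  · rw [h]
  · exact_mod_cast (hA.2 b hb h i).le

theorem IsUniqueMaxExponent.ne_zero {A : LaurentPoly ι} {a : ι → ℚ}
    (hA : IsUniqueMaxExponent A a) : A ≠ 0 := by
  rintro rfl
  exact absurd hA.1 (by simp)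

/-- Euclidean division by a Laurent polynomial with a unique maximal term of coefficient one
terminates and computes the decomposition into a polynomial and a negative degree part. -/
theorem exists_euclideanDivision [Finite ι] {A : LaurentPoly ι} {a : ι → ℚ}
    (hA : IsUniqueMaxExponent A a) (hAa : A.coeff a = 1) {S : AddSubgroup (ι → ℚ)}
    (hAS : IsIntegralOn (S : Set (ι → ℚ)) A) {B : LaurentPoly ι}
    (hB : IsIntegralOn (S : Set (ι → ℚ)) B) :
    ∃ C R : LaurentPoly ι, EuclideanDivision A a B C R ∧
      IsIntegralOn (S : Set (ι → ℚ)) C ∧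
      IsPolyNegDecomposition (toRat B / toRat A) C (toRat R / toRat A) := by
  obtain ⟨C, R, h, hC, hC0, hR, hBC⟩ := exists_division_from hA hAa hAS B 0 0 hB
    (.zero _) (by simp) (by simp)
  refine ⟨C, R, h, hC, ?_, hC0, fun i => ⟨R, A, hA.ne_zero, rfl, ?_⟩⟩
  · rw [zero_mul, add_zero, add_zero] at hBC
    rw [hBC, toRat_add, toRat_mul, add_div, mul_div_cancel_right₀ _ (toRat_ne_zero hA.ne_zero)]
  · rw [hA.degreeIn_eq]
    by_cases hR0 : R = 0
    · simp [hR0]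
    · obtain ⟨β, hβ, hd⟩ := exists_degreeIn_eq i hR0
      rw [hd]
      exact_mod_cast hR β hβ i

end Laurent

namespace PlumbingGraph

variable {V : Type*} [Fintype V] (Γ : PlumbingGraph V)

/-! ### The dual vectors -/

theorem isUnit_det_form : IsUnit Γ.form.det := by
  rw [isUnit_iff_ne_zero]
  intro h
  obtain ⟨x, hx, hx0⟩ := Matrix.exists_mulVec_eq_zero_iff.2 h
  have := Γ.negDef x hx
  change x ⬝ᵥ Γ.form.mulVec x < 0 at this
  rw [hx0, dotProduct_zero] at this
  exact this.false

theorem form_mulVec_dualVec (v : V) : Γ.form.mulVec (Γ.dualVec v) = -Pi.single v 1 := by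
  have h : Γ.dualVec v = -(Γ.form⁻¹.mulVec (Pi.single v 1)) := by
    ext w
    simp [dualVec]
  rw [h, Matrix.mulVec_neg, Matrix.mulVec_mulVec, Matrix.mul_nonsing_inv _ Γ.isUnit_det_form,
    Matrix.one_mulVec]

theorem dualVec_mem_dualLattice (v : V) : Γ.dualVec v ∈ Γ.dualLattice := by
  intro w
  rw [form_mulVec_dualVec, Pi.neg_apply, Pi.single_apply]
  split_ifs
  exacts [⟨-1, by simp⟩, ⟨0, by simp⟩]

theorem form_apply_nonneg {u w : V} (h : u ≠ w) : 0 ≤ Γ.form u w := by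
  simp only [form, intersectionMatrix, Matrix.of_apply, if_neg h]
  split_ifs <;> norm_num

theorem form_apply_adj {u w : V} (h : Γ.graph.Adj u w) : Γ.form u w = 1 := by
  simp [form, intersectionMatrix, h.ne, h]

/-- A vector whose intersection numbers with all `E_v` are nonpositive is effective. -/
theorem nonneg_of_mulVec_nonpos {x : V → ℚ} (hx : Γ.form.mulVec x ≤ 0) : 0 ≤ x := by
  -- Write `x = p - m` with disjointly supported `p, m ≥ 0`. Then `(m, x) ≤ 0`, while `(m, p) ≥ 0`
  -- because off-diagonal entries are nonnegative, so `(m, m) ≥ 0`. Definiteness gives `m = 0`.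
  set m : V → ℚ := x⁻ with hm
  set p : V → ℚ := x⁺ with hp
  have hxpm : x = p - m := (posPart_sub_negPart x).symm
  have hm0 : 0 ≤ m := negPart_nonneg x
  have hp0 : 0 ≤ p := posPart_nonneg x
  have hpm : ∀ v, m v * p v = 0 := fun v => by
    have h1 : m v = (x v)⁻ := Pi.negPart_apply x v
    have h2 : p v = (x v)⁺ := Pi.posPart_apply x v
    rcases le_total 0 (x v) with h | h
    · rw [h1, negPart_eq_zero.2 h, zero_mul]
    · rw [h2, posPart_eq_zero.2 h, mul_zero]
  by_contra hneg
  have hmne : m ≠ 0 := fun h => hneg (negPart_eq_zero.1 h)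
  have h1 : m ⬝ᵥ Γ.form.mulVec x ≤ 0 :=
    Finset.sum_nonpos fun v _ => mul_nonpos_of_nonneg_of_nonpos (hm0 v) (hx v)
  have h2 : 0 ≤ m ⬝ᵥ Γ.form.mulVec p := by
    refine Finset.sum_nonneg fun v _ => ?_
    rw [Matrix.mulVec, dotProduct, Finset.mul_sum]
    refine Finset.sum_nonneg fun w _ => ?_
    by_cases hvw : v = w
    · subst hvw
      rw [mul_left_comm, hpm, mul_zero]
    · exact mul_nonneg (hm0 v) (mul_nonneg (Γ.form_apply_nonneg hvw) (hp0 w))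
  have h3 : m ⬝ᵥ Γ.form.mulVec m < 0 := Γ.negDef m hmne
  rw [hxpm, Matrix.mulVec_sub, dotProduct_sub] at h1
  linarith

theorem dualVec_pos (v w : V) : 0 < Γ.dualVec v w := by
  have hle : Γ.form.mulVec (Γ.dualVec v) ≤ 0 := by
    rw [form_mulVec_dualVec, neg_nonpos]
    exact Pi.single_nonneg.2 zero_le_one
  have h0 : 0 ≤ Γ.dualVec v := Γ.nonneg_of_mulVec_nonpos hle
  -- At a zero `u` of the effective vector `E_v^*`, the number `(E_v^*, E_u) ≤ 0` is a sum of
  -- nonnegative terms. All vanish, so zeros spread along edges and, by connectedness, to the whole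
  -- tree.
  have hadj : ∀ u u', Γ.graph.Adj u u' → Γ.dualVec v u = 0 → Γ.dualVec v u' = 0 := by
    intro u u' huu' hu
    have hterm : ∀ t ∈ Finset.univ, 0 ≤ Γ.form u t * Γ.dualVec v t := fun t _ => by
      by_cases hut : u = t
      · rw [← hut, hu, mul_zero]
      · exact mul_nonneg (Γ.form_apply_nonneg hut) (h0 t)
    have hsum : ∑ t, Γ.form u t * Γ.dualVec v t = 0 :=
      le_antisymm (hle u) (Finset.sum_nonneg hterm)
    have := (Finset.sum_eq_zero_iff_of_nonneg hterm).1 hsum u' (Finset.mem_univ _)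
    rwa [Γ.form_apply_adj huu', one_mul] at this
  refine lt_of_le_of_ne (h0 w) fun hw => ?_
  have hall : ∀ u, Γ.dualVec v u = 0 := by
    intro u
    obtain ⟨p⟩ := Γ.isTree.connected.preconnected w u
    induction p with
    | nil => exact hw.symm
    | cons h _ ih => exact ih (hadj _ _ h hw.symm).symm
  have := congrFun (Γ.form_mulVec_dualVec v) v
  rw [show Γ.dualVec v = 0 from funext hall] at this
  simp at this

/-- A positive multiple of `E_v^*` which lies in `L`. -/
noncomputable def dualOrder (v : V) : ℕ := ∏ w, (Γ.dualVec v w).den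

theorem dualOrder_pos (v : V) : 0 < Γ.dualOrder v := Finset.prod_pos fun _ _ => Rat.den_pos _

theorem dualOrder_nsmul_mem_lattice (v : V) : Γ.dualOrder v • Γ.dualVec v ∈ Γ.lattice := by
  intro w
  obtain ⟨k, hk⟩ : (Γ.dualVec v w).den ∣ Γ.dualOrder v :=
    Finset.dvd_prod_of_mem (fun w => (Γ.dualVec v w).den) (Finset.mem_univ w)
  refine ⟨(Γ.dualVec v w).num * k, ?_⟩
  rw [Pi.smul_apply, nsmul_eq_mul, hk]
  have := Rat.mul_den_eq_num (Γ.dualVec v w)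
  push_cast
  rw [← this]
  ring

/-! ### The substitution `x_v ↦ t^{E_v^*}` -/

/-- The exponent `∑ k_v E_v^*`. -/
noncomputable def dualComb : (V →₀ ℕ) →+ (V → ℚ) where
  toFun k := ∑ v, k v • Γ.dualVec v
  map_zero' := by simp
  map_add' k l := by simp [add_smul, Finset.sum_add_distrib]

theorem dualComb_apply (k : V →₀ ℕ) : Γ.dualComb k = ∑ v, k v • Γ.dualVec v := rfl

theorem dualComb_single (v : V) (n : ℕ) :
    Γ.dualComb (Finsupp.single v n) = n • Γ.dualVec v := by
  rw [dualComb_apply, Finset.sum_eq_single v]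
  · simp
  · intro w _ hw
    simp [Finsupp.single_eq_of_ne hw]
  · simp

theorem dualComb_mem_dualLattice (k : V →₀ ℕ) : Γ.dualComb k ∈ Γ.dualLattice :=
  Γ.dualLattice.sum_mem fun v _ => Γ.dualLattice.nsmul_mem (Γ.dualVec_mem_dualLattice v) _

/-- The multiplicities are recovered as `k_w = -(∑ k_v E_v^*, E_w)`. This is what lets series on the
Lipman cone be treated as power series in the `x_v`. -/
theorem dualComb_injective : Function.Injective Γ.dualComb := by
  intro k l h
  have hform : ∀ (k : V →₀ ℕ) (w : V), Γ.form.mulVec (Γ.dualComb k) w = -(k w : ℚ) := by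
    intro k w
    rw [dualComb_apply, Matrix.mulVec_sum]
    simp only [Matrix.mulVec_smul, form_mulVec_dualVec, Finset.sum_apply, Pi.smul_apply,
      Pi.neg_apply, Pi.single_apply]
    simp
  ext w
  have := hform k w
  rw [h, hform l w] at this
  exact_mod_cast (neg_injective this).symm

theorem substDual_monomial (k : V →₀ ℕ) (c : ℂ) :
    Γ.substDual (MvPolynomial.monomial k c) = AddMonoidAlgebra.single (Γ.dualComb k) c := by
  rw [substDual, MvPolynomial.aeval_monomial, Finsupp.prod_fintype _ _ fun _ => pow_zero _]
  have h : ∏ v, monom (Γ.dualVec v) ^ k v = monom (Γ.dualComb k) := by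
    simp only [← monom_nsmul, dualComb_apply]
    exact (map_prod (AddMonoidAlgebra.of ℂ (V → ℚ))
      (fun v => Multiplicative.ofAdd (k v • Γ.dualVec v)) Finset.univ).symm
  rw [h, ← Algebra.smul_def, monom, AddMonoidAlgebra.smul_single, smul_eq_mul, mul_one]

theorem substDual_add (P Q : MvPolynomial V ℂ) :
    Γ.substDual (P + Q) = Γ.substDual P + Γ.substDual Q := map_add _ _ _
theorem substDual_sub (P Q : MvPolynomial V ℂ) :
    Γ.substDual (P - Q) = Γ.substDual P - Γ.substDual Q := map_sub _ _ _
theorem substDual_mul (P Q : MvPolynomial V ℂ) :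
    Γ.substDual (P * Q) = Γ.substDual P * Γ.substDual Q := map_mul _ _ _
theorem substDual_pow (P : MvPolynomial V ℂ) (n : ℕ) :
    Γ.substDual (P ^ n) = Γ.substDual P ^ n := map_pow _ _ _
theorem substDual_prod {κ : Type*} (s : Finset κ) (P : κ → MvPolynomial V ℂ) :
    Γ.substDual (∏ k ∈ s, P k) = ∏ k ∈ s, Γ.substDual (P k) := map_prod (MvPolynomial.aeval _) _ _
theorem substDual_sum {κ : Type*} (s : Finset κ) (P : κ → MvPolynomial V ℂ) :
    Γ.substDual (∑ k ∈ s, P k) = ∑ k ∈ s, Γ.substDual (P k) := map_sum (MvPolynomial.aeval _) _ _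
@[simp] theorem substDual_one : Γ.substDual 1 = 1 := map_one (MvPolynomial.aeval _)
@[simp] theorem substDual_X (v : V) : Γ.substDual (MvPolynomial.X v) = monom (Γ.dualVec v) :=
  MvPolynomial.aeval_X _ _

theorem coeff_substDual (P : MvPolynomial V ℂ) (k : V →₀ ℕ) :
    (Γ.substDual P).coeff (Γ.dualComb k) = P.coeff k := by
  induction P using MvPolynomial.induction_on' with
  | monomial l c =>
    rw [substDual_monomial, AddMonoidAlgebra.coeff_single, Finsupp.single_apply,
      MvPolynomial.coeff_monomial]
    simp only [Γ.dualComb_injective.eq_iff]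
  | add P Q hP hQ => rw [substDual_add, AddMonoidAlgebra.coeff_add, Finsupp.add_apply, hP, hQ,
      MvPolynomial.coeff_add]

theorem substDual_injective : Function.Injective Γ.substDual := fun P Q h => by
  ext k
  rw [← coeff_substDual, h, coeff_substDual]

theorem substDual_ne_zero {P : MvPolynomial V ℂ} (hP : P ≠ 0) : Γ.substDual P ≠ 0 := fun h =>
  hP (Γ.substDual_injective (h.trans (map_zero (MvPolynomial.aeval _)).symm))

/-! ### Uniqueness of the reduced zeta-function -/

/-- Injectivity of the substitution lifts the cross-multiplied identity to polynomials in the `x_v`,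
and power series form a domain. -/
theorem IsTaylorExpansion.series_unique {F : RatFun V} {S S' : MvPowerSeries V ℂ}
    (h : Γ.IsTaylorExpansion F S) (h' : Γ.IsTaylorExpansion F S') : S = S' := by
  obtain ⟨A, B, hA, hS, hF⟩ := h
  obtain ⟨A', B', hA', hS', hF'⟩ := h'
  rw [hF, toRat_div_eq_div_iff (Γ.substDual_ne_zero hA) (Γ.substDual_ne_zero hA'),
    ← substDual_mul, ← substDual_mul] at hF'
  have h := congrArg (fun P : MvPolynomial V ℂ => (P : MvPowerSeries V ℂ))
    (Γ.substDual_injective hF')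
  simp only [MvPolynomial.coe_mul, ← hS, ← hS'] at h
  have hAA : (A : MvPowerSeries V ℂ) * A' ≠ 0 :=
    mul_ne_zero (mt MvPolynomial.coe_eq_zero_iff.1 hA) (mt MvPolynomial.coe_eq_zero_iff.1 hA')
  refine mul_left_cancel₀ hAA ?_
  linear_combination h

theorem IsTaylorExpansion.function_unique {F F' : RatFun V} {S : MvPowerSeries V ℂ}
    (h : Γ.IsTaylorExpansion F S) (h' : Γ.IsTaylorExpansion F' S) : F = F' := by
  obtain ⟨A, B, hA, hS, rfl⟩ := h
  obtain ⟨A', B', hA', hS', rfl⟩ := h'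
  rw [toRat_div_eq_div_iff (Γ.substDual_ne_zero hA) (Γ.substDual_ne_zero hA'),
    ← substDual_mul, ← substDual_mul]
  congr 1
  apply MvPolynomial.coe_injective
  rw [MvPolynomial.coe_mul, MvPolynomial.coe_mul, ← hS, ← hS']
  ring

/-- The cross-multiplied identity survives the ring homomorphism, and both specialized denominators
are nonzero. -/
theorem IsSpecialization.unique {F : RatFun V} {f f' : RatFun Γ.Node}
    (h : Γ.IsSpecialization F f) (h' : Γ.IsSpecialization F f') : f = f' := by
  obtain ⟨A, B, hA, hF, rfl⟩ := h
  obtain ⟨A', B', hA', hF', rfl⟩ := h'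
  have hA0 : A ≠ 0 := fun h => hA (by rw [h, map_zero])
  have hA0' : A' ≠ 0 := fun h => hA' (by rw [h, map_zero])
  rw [hF, toRat_div_eq_div_iff hA0 hA0'] at hF'
  rw [toRat_div_eq_div_iff hA hA', ← map_mul, ← map_mul, hF']

theorem IsReducedZeta.unique {h : Γ.H} {f f' : RatFun Γ.Node}
    (hf : Γ.IsReducedZeta h f) (hf' : Γ.IsReducedZeta h f') : f = f' := by
  obtain ⟨F, ⟨Z, hZ, hF⟩, hs⟩ := hf
  obtain ⟨F', ⟨Z', hZ', hF'⟩, hs'⟩ := hf'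
  obtain rfl := hZ.series_unique Γ hZ'
  obtain rfl := hF.function_unique Γ hF'
  exact hs.unique Γ hs'

/-! ### Existence of the reduced zeta-function -/

theorem hasClass_add_iff {l m : V → ℚ} {h : Γ.H} (hm : m ∈ Γ.lattice)
    (hm' : m ∈ Γ.dualLattice) : Γ.HasClass (m + l) h ↔ Γ.HasClass l h := by
  have key : ∀ (hl : l ∈ Γ.dualLattice) (hml : m + l ∈ Γ.dualLattice),
      ((⟨m + l, hml⟩ : Γ.dualLattice) : Γ.H) = ((⟨l, hl⟩ : Γ.dualLattice) : Γ.H) := by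
    intro hl hml
    rw [eq_comm, QuotientAddGroup.eq, AddSubgroup.mem_addSubgroupOf]
    simpa using hm
  constructor
  · rintro ⟨hml, rfl⟩
    have hl : l ∈ Γ.dualLattice := by
      have := Γ.dualLattice.sub_mem hml hm'
      rwa [add_sub_cancel_left] at this
    exact ⟨hl, (key hl hml).symm⟩
  · rintro ⟨hl, rfl⟩
    exact ⟨Γ.dualLattice.add_mem hm' hl, key hl _⟩

theorem coeff_seriesPart (h : Γ.H) (S : MvPowerSeries V ℂ) (k : V →₀ ℕ) :
    MvPowerSeries.coeff k (Γ.seriesPart h S) =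
      if Γ.HasClass (Γ.dualComb k) h then MvPowerSeries.coeff k S else 0 := rfl

theorem seriesPart_sub (h : Γ.H) (S T : MvPowerSeries V ℂ) :
    Γ.seriesPart h (S - T) = Γ.seriesPart h S - Γ.seriesPart h T := by
  ext k
  simp only [map_sub, coeff_seriesPart]
  split_ifs <;> simp

/-- Shifting exponents by an element of `L` does not change their class in `H`. -/
theorem seriesPart_monomial_mul (h : Γ.H) {k : V →₀ ℕ} (hk : Γ.dualComb k ∈ Γ.lattice) (c : ℂ)
    (S : MvPowerSeries V ℂ) :
    Γ.seriesPart h (MvPowerSeries.monomial k c * S) =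
      MvPowerSeries.monomial k c * Γ.seriesPart h S := by
  ext l
  rw [coeff_seriesPart, MvPowerSeries.coeff_monomial_mul, MvPowerSeries.coeff_monomial_mul,
    coeff_seriesPart]
  by_cases hkl : k ≤ l
  · have : Γ.HasClass (Γ.dualComb l) h ↔ Γ.HasClass (Γ.dualComb (l - k)) h := by
      rw [← Γ.hasClass_add_iff (l := Γ.dualComb (l - k)) hk (Γ.dualComb_mem_dualLattice k),
        ← map_add, add_tsub_cancel_of_le hkl]
    simp only [this, if_pos hkl, mul_ite, mul_zero]
  · simp only [if_neg hkl, ite_self]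

/-- The factor `1 - x_v^d`, where `d E_v^* ∈ L`. -/
noncomputable def periodFactor (v : V) : MvPolynomial V ℂ := 1 - MvPolynomial.X v ^ Γ.dualOrder v

/-- The common denominator `∏ (1 - x_v^d)^2` of the parts of the zeta-function. -/
noncomputable def commonDenom : MvPolynomial V ℂ := ∏ v, Γ.periodFactor v ^ 2

theorem seriesPart_commonDenom_mul (h : Γ.H) (S : MvPowerSeries V ℂ) :
    Γ.seriesPart h ((Γ.commonDenom : MvPowerSeries V ℂ) * S) =
      (Γ.commonDenom : MvPowerSeries V ℂ) * Γ.seriesPart h S := by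
  revert S
  refine Finset.prod_induction (fun v => Γ.periodFactor v ^ 2)
    (fun P => ∀ S, Γ.seriesPart h ((P : MvPowerSeries V ℂ) * S) =
      (P : MvPowerSeries V ℂ) * Γ.seriesPart h S) ?_ ?_ ?_
  · intro P Q hP hQ S
    rw [MvPolynomial.coe_mul, mul_assoc, hP, hQ, mul_assoc]
  · intro S
    rw [MvPolynomial.coe_one, one_mul, one_mul]
  · intro v _ S
    have hv : ∀ S, Γ.seriesPart h ((Γ.periodFactor v : MvPowerSeries V ℂ) * S) =
        (Γ.periodFactor v : MvPowerSeries V ℂ) * Γ.seriesPart h S := by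
      intro S
      have hc : (Γ.periodFactor v : MvPowerSeries V ℂ) =
          1 - MvPowerSeries.monomial (Finsupp.single v (Γ.dualOrder v)) 1 := by
        rw [← MvPowerSeries.X_pow_eq, ← MvPolynomial.coe_X, ← MvPolynomial.coe_pow,
          ← MvPolynomial.coe_one]
        exact map_sub MvPolynomial.coeToMvPowerSeries.ringHom _ _
      rw [hc, sub_mul, sub_mul, one_mul, one_mul, seriesPart_sub, seriesPart_monomial_mul]
      rw [dualComb_single]
      exact Γ.dualOrder_nsmul_mem_lattice v
    rw [MvPolynomial.coe_pow, pow_two, mul_assoc, hv, hv, mul_assoc]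

/-- The part of a polynomial in the `x_v = t^{E_v^*}` whose exponents have class `h`. -/
noncomputable def polyPart (h : Γ.H) (P : MvPolynomial V ℂ) : MvPolynomial V ℂ :=
  ∑ k ∈ P.support with Γ.HasClass (Γ.dualComb k) h, MvPolynomial.monomial k (P.coeff k)

theorem coe_polyPart (h : Γ.H) (P : MvPolynomial V ℂ) :
    (Γ.polyPart h P : MvPowerSeries V ℂ) = Γ.seriesPart h (P : MvPowerSeries V ℂ) := by
  ext k
  rw [coeff_seriesPart, MvPolynomial.coeff_coe, MvPolynomial.coeff_coe, polyPart,
    MvPolynomial.coeff_sum]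
  simp only [MvPolynomial.coeff_monomial, Finset.sum_ite_eq', Finset.mem_filter,
    MvPolynomial.mem_support_iff]
  by_cases hk : P.coeff k = 0 <;> simp [hk]

/-- The numerator of the zeta-function over the common denominator. -/
noncomputable def commonNum : MvPolynomial V ℂ :=
  ∏ v, ((1 - MvPolynomial.X v) ^ Γ.valency v *
    (∑ j ∈ Finset.range (Γ.dualOrder v), MvPolynomial.X v ^ j) ^ 2)

theorem one_sub_monom_ne_zero {κ : Type*} {β : κ → ℚ} (hβ : β ≠ 0) :
    (1 : LaurentPoly κ) - monom β ≠ 0 := by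
  rw [← monom_zero, sub_ne_zero]
  intro h
  exact hβ (AddMonoidAlgebra.single_left_injective one_ne_zero h).symm

theorem dualVec_ne_zero (v : V) : Γ.dualVec v ≠ 0 := fun h =>
  (Γ.dualVec_pos v v).ne' (congrFun h v)

theorem periodFactor_eq (v : V) : Γ.periodFactor v =
    (∑ j ∈ Finset.range (Γ.dualOrder v), MvPolynomial.X v ^ j) * (1 - MvPolynomial.X v) := by
  rw [periodFactor, geom_sum_mul_neg]

theorem substDual_periodFactor (v : V) :
    Γ.substDual (Γ.periodFactor v) = 1 - monom (Γ.dualOrder v • Γ.dualVec v) := by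
  rw [periodFactor, substDual_sub, substDual_one, substDual_pow, substDual_X, monom_nsmul]

theorem substDual_periodFactor_ne_zero (v : V) : Γ.substDual (Γ.periodFactor v) ≠ 0 := by
  rw [substDual_periodFactor]
  exact one_sub_monom_ne_zero (smul_ne_zero (Γ.dualOrder_pos v).ne' (Γ.dualVec_ne_zero v))

theorem substDual_commonDenom :
    Γ.substDual Γ.commonDenom = ∏ v, (1 - monom (Γ.dualOrder v • Γ.dualVec v)) ^ 2 := by
  simp only [commonDenom, substDual_prod, substDual_pow, substDual_periodFactor]

theorem commonDenom_ne_zero : Γ.commonDenom ≠ 0 := by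
  refine Finset.prod_ne_zero_iff.2 fun v _ => pow_ne_zero _ fun h => ?_
  exact Γ.substDual_periodFactor_ne_zero v (by rw [h]; exact map_zero (MvPolynomial.aeval _))

/-- Multiplying numerator and denominator by the squared geometric sum turns `(1 - x)^(δ - 2)` into
`(1 - x)^δ (1 + ⋯ + x^(d-1))^2 / (1 - x^d)^2`, uniformly in `δ`, so ends of the tree need no
separate case. -/
theorem zeta_eq :
    Γ.zeta = toRat (Γ.substDual Γ.commonNum) / toRat (Γ.substDual Γ.commonDenom) := by
  simp only [zeta, commonNum, commonDenom, substDual_prod, toRat_prod]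
  rw [← Finset.prod_div_distrib]
  refine Finset.prod_congr rfl fun v _ => ?_
  have h1 : toRat (1 - monom (Γ.dualVec v)) ≠ 0 :=
    toRat_ne_zero (one_sub_monom_ne_zero (Γ.dualVec_ne_zero v))
  have h2 := toRat_ne_zero (Γ.substDual_periodFactor_ne_zero v)
  rw [periodFactor_eq, substDual_mul, toRat_mul] at h2
  have h3 := left_ne_zero_of_mul h2
  rw [periodFactor_eq]
  simp only [substDual_mul, substDual_pow, substDual_sub, substDual_one, substDual_X, toRat_mul,
    toRat_pow, mul_pow]
  rw [toRat_sub, toRat_one] at h1 ⊢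
  rw [zpow_sub₀ h1, zpow_natCast]
  rw [mul_comm (_ ^ 2) (_ ^ 2), mul_div_mul_right _ _ (pow_ne_zero 2 h3)]
  norm_cast

theorem constantCoeff_commonDenom :
    MvPowerSeries.constantCoeff (Γ.commonDenom : MvPowerSeries V ℂ) = 1 := by
  rw [← MvPowerSeries.coeff_zero_eq_constantCoeff_apply, MvPolynomial.coeff_coe,
    ← MvPolynomial.constantCoeff_eq, commonDenom, map_prod]
  refine Finset.prod_eq_one fun v _ => ?_
  simp [periodFactor, (Γ.dualOrder_pos v).ne']

theorem exists_isTaylorExpansion_zeta :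
    ∃ Z : MvPowerSeries V ℂ, Γ.IsTaylorExpansion Γ.zeta Z ∧
      (Γ.commonDenom : MvPowerSeries V ℂ) * Z = (Γ.commonNum : MvPowerSeries V ℂ) := by
  have h : (Γ.commonDenom : MvPowerSeries V ℂ) *
      ((Γ.commonDenom : MvPowerSeries V ℂ)⁻¹ * (Γ.commonNum : MvPowerSeries V ℂ)) =
      (Γ.commonNum : MvPowerSeries V ℂ) := by
    rw [← mul_assoc, MvPowerSeries.mul_inv_cancel _ (by simp [constantCoeff_commonDenom]), one_mul]
  exact ⟨_, ⟨Γ.commonDenom, Γ.commonNum, Γ.commonDenom_ne_zero, h, Γ.zeta_eq⟩, h⟩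

/-- The denominator of the reduced zeta-function. -/
noncomputable def reducedDenom : LaurentPoly Γ.Node := Γ.specialize (Γ.substDual Γ.commonDenom)

/-- The numerator of the reduced zeta-function. -/
noncomputable def reducedNum (h : Γ.H) : LaurentPoly Γ.Node :=
  Γ.specialize (Γ.substDual (Γ.polyPart h Γ.commonNum))

/-! ### The reduced fraction: leading term and integrality -/

theorem specialize_single (β : V → ℚ) (c : ℂ) :
    Γ.specialize (AddMonoidAlgebra.single β c) = AddMonoidAlgebra.single (Γ.proj β) c :=
  AddMonoidAlgebra.mapDomain_single

theorem reducedDenom_eq :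
    Γ.reducedDenom = ∏ v, (1 - monom (Γ.proj (Γ.dualOrder v • Γ.dualVec v))) ^ 2 := by
  simp only [reducedDenom, substDual_commonDenom, map_prod, map_pow, map_sub, map_one, monom,
    specialize_single]

theorem isUniqueMaxExponent_one {κ : Type*} :
    IsUniqueMaxExponent (1 : LaurentPoly κ) 0 ∧ (1 : LaurentPoly κ).coeff 0 = 1 := by
  rw [← monom_zero, monom]
  refine ⟨⟨by simp, fun b hb hb0 => ?_⟩, by simp⟩
  rw [AddMonoidAlgebra.coeff_single] at hb
  exact absurd (Finset.mem_singleton.1 (Finsupp.support_single_subset hb)) hb0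

/-- For an empty index set `StrongLT 0 β` holds vacuously and `1 - monom β` vanishes, hence the
extra condition `β ≠ 0`. -/
theorem isUniqueMaxExponent_one_sub_monom {κ : Type*} {β : κ → ℚ} (hβ : StrongLT 0 β)
    (hβ0 : β ≠ 0) :
    IsUniqueMaxExponent (1 - monom β) β ∧ (1 - monom β).coeff β = -1 := by
  have hc : (1 - monom β).coeff = Finsupp.single 0 1 - Finsupp.single β (1 : ℂ) := rfl
  have h1 : (1 - monom β).coeff β = -1 := by
    rw [hc, Finsupp.sub_apply, Finsupp.single_eq_same, Finsupp.single_eq_of_ne hβ0, zero_sub]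
  refine ⟨⟨by rw [Finsupp.mem_support_iff, h1]; norm_num, fun b hb hbβ => ?_⟩, h1⟩
  rw [hc] at hb
  rcases Finset.mem_union.1 (Finsupp.support_sub hb) with hb | hb
  · rw [Finset.mem_singleton.1 (Finsupp.support_single_subset hb)]
    exact hβ
  · exact absurd (Finset.mem_singleton.1 (Finsupp.support_single_subset hb)) hbβ

/-- The exponent of the maximal term of `reducedDenom`. -/
noncomputable def maxExponent : Γ.Node → ℚ :=
  ∑ v, 2 • Γ.proj (Γ.dualOrder v • Γ.dualVec v)

theorem strongLT_zero_proj (v : V) : StrongLT 0 (Γ.proj (Γ.dualOrder v • Γ.dualVec v)) :=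
  fun n => nsmul_pos (Γ.dualVec_pos v n.1) (Γ.dualOrder_pos v).ne'

theorem strongLT_zero_maxExponent : StrongLT 0 Γ.maxExponent := fun n => by
  rw [maxExponent, Finset.sum_apply, Pi.zero_apply]
  exact Finset.sum_pos (fun v _ => nsmul_pos (Γ.strongLT_zero_proj v n) two_ne_zero)
    ⟨n.1, Finset.mem_univ _⟩

theorem proj_ne_zero [Nonempty Γ.Node] (v : V) : Γ.proj (Γ.dualOrder v • Γ.dualVec v) ≠ 0 := by
  intro h
  obtain ⟨n⟩ := ‹Nonempty Γ.Node›
  exact (Γ.strongLT_zero_proj v n).ne (congrFun h n).symm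

theorem isUniqueMaxExponent_reducedDenom [Nonempty Γ.Node] :
    IsUniqueMaxExponent Γ.reducedDenom Γ.maxExponent ∧
      Γ.reducedDenom.coeff Γ.maxExponent = 1 := by
  rw [reducedDenom_eq, maxExponent]
  induction (Finset.univ : Finset V) using Finset.induction_on with
  | empty => simpa using isUniqueMaxExponent_one
  | insert v s hv ih =>
    rw [Finset.prod_insert hv, Finset.sum_insert hv]
    obtain ⟨h1, h2⟩ :=
      isUniqueMaxExponent_one_sub_monom (Γ.strongLT_zero_proj v) (Γ.proj_ne_zero v)
    -- Squaring the factor turns its leading coefficient `-1` into `1`.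
    obtain ⟨h3, h4⟩ := h1.mul h1
    rw [pow_two, two_nsmul]
    obtain ⟨h5, h6⟩ := h3.mul ih.1
    exact ⟨h5, by rw [h6, h4, h2, ih.2]; norm_num⟩

theorem projDualLattice_eq :
    Γ.projDualLattice = (Γ.dualLattice.map Γ.proj : Set (Γ.Node → ℚ)) := rfl

theorem isIntegralOn_reducedDenom : IsIntegralOn Γ.projDualLattice Γ.reducedDenom := by
  rw [projDualLattice_eq, reducedDenom_eq]
  refine IsIntegralOn.prod _ fun v _ => IsIntegralOn.pow ((isIntegralOn_one _).sub
    (isIntegralOn_monom ?_)) _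
  exact AddSubgroup.mem_map_of_mem _
    (Γ.dualLattice.nsmul_mem (Γ.dualVec_mem_dualLattice v) _)

/-- The same product formula makes sense over `ℤ`, and base change to `ℂ` gives `commonNum`. -/
theorem commonNum_coeff_int (k : V →₀ ℕ) : ∃ z : ℤ, Γ.commonNum.coeff k = z := by
  have h : Γ.commonNum = MvPolynomial.map (Int.castRingHom ℂ)
      (∏ v, ((1 - MvPolynomial.X v) ^ Γ.valency v *
        (∑ j ∈ Finset.range (Γ.dualOrder v), MvPolynomial.X v ^ j) ^ 2)) := by
    simp [commonNum]
  exact ⟨_, by rw [h, MvPolynomial.coeff_map]; rfl⟩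

theorem isIntegralOn_reducedNum (h : Γ.H) : IsIntegralOn Γ.projDualLattice (Γ.reducedNum h) := by
  rw [projDualLattice_eq, reducedNum, polyPart, substDual_sum, map_sum]
  refine IsIntegralOn.sum _ fun k _ => ?_
  obtain ⟨z, hz⟩ := Γ.commonNum_coeff_int k
  rw [substDual_monomial, specialize_single, hz]
  exact isIntegralOn_single (AddSubgroup.mem_map_of_mem _ (Γ.dualComb_mem_dualLattice k)) z

/-- Taking the `h`-part of `D Z = N` and moving it past `D` gives `D Z_h = N_h`. A node is needed
for `D` to remain nonzero after specialization. -/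
theorem isReducedZeta [Nonempty Γ.Node] (h : Γ.H) :
    Γ.IsReducedZeta h (toRat (Γ.reducedNum h) / toRat Γ.reducedDenom) := by
  obtain ⟨Z, hZ, hDZ⟩ := Γ.exists_isTaylorExpansion_zeta
  refine ⟨toRat (Γ.substDual (Γ.polyPart h Γ.commonNum)) / toRat (Γ.substDual Γ.commonDenom),
    ⟨Z, hZ, Γ.commonDenom, Γ.polyPart h Γ.commonNum, Γ.commonDenom_ne_zero, ?_, rfl⟩,
    _, _, Γ.isUniqueMaxExponent_reducedDenom.1.ne_zero, rfl, rfl⟩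
  rw [← seriesPart_commonDenom_mul, hDZ, coe_polyPart]

end PlumbingGraph

/-! ### The main theorem -/

theorem mainTheorem2 {V : Type*} [Fintype V] (Γ : PlumbingGraph V) (hN : Nonempty Γ.Node)
    (h : Γ.H) :
    (∃! f : RatFun Γ.Node, Γ.IsReducedZeta h f) ∧
    ∀ f : RatFun Γ.Node, Γ.IsReducedZeta h f →
      (∃! p : LaurentPoly Γ.Node × RatFun Γ.Node, IsPolyNegDecomposition f p.1 p.2) ∧
      ∀ (P : LaurentPoly Γ.Node) (g : RatFun Γ.Node), IsPolyNegDecomposition f P g →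
        IsIntegralOn Γ.projDualLattice P ∧
        ∃ (A B R : LaurentPoly Γ.Node) (a : Γ.Node → ℚ),
          IsIntegralOn Γ.projDualLattice A ∧ IsIntegralOn Γ.projDualLattice B ∧
          IsUniqueMaxExponent A a ∧ StrongLT 0 a ∧
          f = toRat B / toRat A ∧
          EuclideanDivision A a B P R ∧
          g = toRat R / toRat A := by
  refine ⟨⟨_, Γ.isReducedZeta h, fun f hf => hf.unique Γ (Γ.isReducedZeta h)⟩, fun f hf => ?_⟩
  obtain rfl := hf.unique Γ (Γ.isReducedZeta h)
  obtain ⟨hmax, hcoeff⟩ := Γ.isUniqueMaxExponent_reducedDenom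
  obtain ⟨C, R, hdiv, hC, hdec⟩ := exists_euclideanDivision
    (S := Γ.dualLattice.map Γ.proj) hmax hcoeff
    Γ.isIntegralOn_reducedDenom (Γ.isIntegralOn_reducedNum h)
  refine ⟨⟨(C, _), hdec, fun p hp => Prod.ext (hp.unique hdec).1 (hp.unique hdec).2⟩,
    fun P g hPg => ?_⟩
  obtain ⟨rfl, rfl⟩ := hPg.unique hdec
  exact ⟨hC, _, _, R, _, Γ.isIntegralOn_reducedDenom, Γ.isIntegralOn_reducedNum h, hmax,
    Γ.strongLT_zero_maxExponent, rfl, hdiv, rfl⟩
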